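/- Let $\chi$ be a probability distribution on $\mathbb{N}_0$ and let $p_{-1},p_0,p_1\ge 0$ with $p_{-1}+p_0+p_1=1$. Let $T$ be the rooted Galton–Watson tree with offspring distribution $\chi$, in which every edge is assigned, independently of all else, a weight equal to $-1$, $0$ or $1$ with probability $p_{-1}$, $p_0$ or $p_1$ respectively. Fix a target capital $\kappa$ and $i,j\in\{1,\dots,\kappa-1\}$. In the weighted-tree-percolation game, a token starts at the root of $T$; players $P_1$ and $P_2$ start with capitals $i$ and $j$, and, with $P_1$ moving first, alternately move the token from its current vertex to a child of that vertex, the player who moves adding the weight of the traversed edge to her capital. The whole weighted tree is known to both players. The game ends as soon as a player's capital reaches $\kappa$ (she wins), or a player's capital drops to $0$ (she loses), or, if neither of these has happened, the player whose turn it is has the token at a leaf (she loses). The game results in a draw if neither player has a strategy that forces a win. Let $d_{i,j}$ be the probability that the game results in a draw. Let $\kappa=3$ and $p_0=0$ (so that $p_1=1-p_{-1}$, with $p_{-1}\in[0,1]$ arbitrary), and let $\chi$ be either the Dirac measure at $2$ or the Poisson distribution with mean $2$. Then $d_{i,j}=0$ for each $(i,j)\in\{1,2\}^2$. -/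

import Mathlib

open MeasureTheory ProbabilityTheory

namespace WeightedTreeGame

/-- A (locally finite) rooted edge-weighted tree in Ulam–Harris form. Vertices are words, the root
is the empty word `[]`, the vertex `u` has `(t u).1` children, namely the words `u ++ [k]` with
`k < (t u).1`, and the edge from the parent of a vertex `v ≠ []` to `v` has the weight `(t v).2`.
Labels of words that are not reached from the root in this way, and the weight label of the root,
play no role. -/
abbrev Tree := List ℕ → ℕ × ℤ

/-- The number of children of the vertex `u`. -/
def Tree.numChildren (t : Tree) (u : List ℕ) : ℕ := (t u).1

/-- The weight of the edge from `u` to its `k`-th child. -/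
def Tree.edgeWeight (t : Tree) (u : List ℕ) (k : ℕ) : ℤ := (t (u ++ [k])).2

/-- The two players. -/
inductive Player
  | one
  | two
  deriving DecidableEq

/-- The opponent of a player. -/
def Player.opponent : Player → Player
  | .one => .two
  | .two => .one

/-- A position of the game: the vertex that carries the token, the current capitals of the two
players, and the player whose turn it is to move. -/
structure Position where
  vertex : List ℕ
  capital : Player → ℤ
  turn : Player

/-- The initial position: the token is at `v`, the first player owns `i`, the second player
owns `j`, and the first player moves first. -/
def startPosition (i j : ℕ) (v : List ℕ) : Position where
  vertex := v
  capital := fun P => match P with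
    | .one => (i : ℤ)
    | .two => (j : ℤ)
  turn := .one

/-- The player whose turn it is moves the token to the `k`-th child of the current vertex and is
awarded the weight of the traversed edge. -/
def move (t : Tree) (p : Position) (k : ℕ) : Position where
  vertex := p.vertex ++ [k]
  capital := Function.update p.capital p.turn (p.capital p.turn + t.edgeWeight p.vertex k)
  turn := p.turn.opponent

/-- In the position `p`, the capitals decide the game in favour of `P`: the player `P` has amassed
the target capital `κ`, or the capital of the opponent of `P` has dwindled to `0`. -/
def CapitalWin (κ : ℕ) (p : Position) (P : Player) : Prop :=
  (κ : ℤ) ≤ p.capital P ∨ p.capital P.opponent ≤ 0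

/-- In the position `p` the game is over and won by `P`: either the capitals decide in favour
of `P`, or the capitals do not decide, and the opponent of `P` has to move from a leaf. -/
def WonBy (t : Tree) (κ : ℕ) (p : Position) (P : Player) : Prop :=
  CapitalWin κ p P ∨
    ((∀ Q, ¬ CapitalWin κ p Q) ∧ p.turn = P.opponent ∧ t.numChildren p.vertex = 0)

/-- A strategy: it picks a child at each vertex that has one. Since the token only moves away from
the root, the current vertex records the whole history of the game, so that these are all the
(history-dependent) strategies. The strategy may depend on the whole tree. -/
def Strategy (t : Tree) : Type :=
  {s : List ℕ → ℕ // ∀ u, 0 < t.numChildren u → s u < t.numChildren u}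

/-- The successive positions when the player `P` follows the strategy `s P`, from the position `p`
on. What comes after the first position in which the game is over is irrelevant. -/
def play (t : Tree) (s : Player → Strategy t) (p : Position) : ℕ → Position
  | 0 => p
  | n + 1 => move t (play t s p n) ((s (play t s p n).turn).1 (play t s p n).vertex)

/-- The game is over after finitely many moves, and `P` is the winner at the first moment at which
it is over. -/
def PlayWonBy (t : Tree) (κ : ℕ) (s : Player → Strategy t) (p : Position) (P : Player) : Prop :=
  ∃ n, WonBy t κ (play t s p n) P ∧ ∀ m < n, ∀ Q, ¬ WonBy t κ (play t s p m) Q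

/-- The player `P` can force a win from the position `p`. -/
def HasWinningStrategy (t : Tree) (κ : ℕ) (p : Position) (P : Player) : Prop :=
  ∃ σ : Strategy t, ∀ s : Player → Strategy t, s P = σ → PlayWonBy t κ s p P

/-- The game with initial capitals `i`, `j`, target capital `κ` and initial vertex `v` on the
tree `t` results in a draw: neither of the two players can force a win. -/
def IsDraw (i j κ : ℕ) (t : Tree) (v : List ℕ) : Prop :=
  ∀ P, ¬ HasWinningStrategy t κ (startPosition i j v) P

/-- The law of an edge weight: `-1`, `0`, `1` with probabilities `pm`, `p0`, `p1`. -/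
noncomputable def weightLaw (pm p0 p1 : ℝ) : Measure ℤ :=
  ENNReal.ofReal pm • Measure.dirac (-1) + ENNReal.ofReal p0 • Measure.dirac 0 +
    ENNReal.ofReal p1 • Measure.dirac 1

/-- The law of the edge-weighted Galton–Watson tree with offspring distribution `χ`: all offspring
numbers have law `χ`, all edge weights have law `weightLaw pm p0 p1`, and all of these are
independent. -/
noncomputable def treeLaw (χ : Measure ℕ) (pm p0 p1 : ℝ) : Measure Tree :=
  Measure.infinitePi fun _ : List ℕ => χ.prod (weightLaw pm p0 p1)

/-- The probability of a draw, for the game that starts at the root. -/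
noncomputable def drawProb (χ : Measure ℕ) (pm p0 p1 : ℝ) (κ i j : ℕ) : ENNReal :=
  treeLaw χ pm p0 p1 {t | IsDraw i j κ t []}

theorem isProbabilityMeasure_weightLaw {pm p0 p1 : ℝ} (hm : 0 ≤ pm) (h0 : 0 ≤ p0) (h1 : 0 ≤ p1)
    (hsum : pm + p0 + p1 = 1) : IsProbabilityMeasure (weightLaw pm p0 p1) := by
  constructor
  simp only [weightLaw, Measure.add_apply, Measure.smul_apply, measure_univ, smul_eq_mul, mul_one]
  rw [← ENNReal.ofReal_add hm h0, ← ENNReal.ofReal_add (add_nonneg hm h0) h1, hsum,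
    ENNReal.ofReal_one]

theorem isProbabilityMeasure_treeLaw (χ : Measure ℕ) [IsProbabilityMeasure χ] {pm p0 p1 : ℝ}
    (hm : 0 ≤ pm) (h0 : 0 ≤ p0) (h1 : 0 ≤ p1) (hsum : pm + p0 + p1 = 1) :
    IsProbabilityMeasure (treeLaw χ pm p0 p1) := by
  have := isProbabilityMeasure_weightLaw hm h0 h1 hsum
  unfold treeLaw
  infer_instance

end WeightedTreeGame

namespace WeightedTreeGame

/-! From a drawn position the mover can pass to a drawn position. With κ = 3 and weights ±1 the
weight of that edge is forced: capital 1 must gain 1, capital 2 must lose 1. So a draw yields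
arbitrarily long downward paths with prescribed weights below one child of the root
(`exists_hasUndecidedPath_of_isDraw`).

The capitals (mover, opponent) run through the cycle (1,1), (1,2), (2,2), (2,1), with weights 1, 1,
-1, -1. The paths thus form a branching process whose mean over four generations is 2⁴(p₁p₋₁)² =
(4p₁p₋₁)² ≤ 1. At criticality, extinction comes from the strict inequality 1 - G(1 - x) < 2x for the
offspring generating function G. The recursion for the path probabilities is
`treeLaw_real_hasUndecidedPath`; their decay is `tendsto_undecidedProb`. -/

/-! ### Plays, strategies and drawn positions. -/

theorem prefix_vertex_play (t : Tree) (s : Player → Strategy t) (p : Position) (n : ℕ) :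
    p.vertex <+: (play t s p n).vertex := by
  induction n with
  | zero => exact List.prefix_rfl
  | succ n ih => exact ih.trans (List.prefix_append _ _)

/-- The course of the play depends only on what the strategies prescribe at the descendants of the
initial vertex. -/
theorem play_congr (t : Tree) {s s' : Player → Strategy t} (p : Position)
    (h : ∀ P u, p.vertex <+: u → (s P).1 u = (s' P).1 u) (n : ℕ) :
    play t s p n = play t s' p n := by
  induction n with
  | zero => rfl
  | succ n ih =>
    simp only [play]
    rw [← ih, h _ _ (prefix_vertex_play t s p n)]

theorem play_succ (t : Tree) (s : Player → Strategy t) (p : Position) (n : ℕ) :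
    play t s p (n + 1) = play t s (move t p ((s p.turn).1 p.vertex)) n := by
  induction n with
  | zero => rfl
  | succ n ih => rw [play, ih]; rfl

theorem PlayWonBy.of_move {t : Tree} {κ : ℕ} {s : Player → Strategy t} {p : Position} {P : Player}
    (hp : ∀ Q, ¬ WonBy t κ p Q) (h : PlayWonBy t κ s (move t p ((s p.turn).1 p.vertex)) P) :
    PlayWonBy t κ s p P := by
  obtain ⟨n, hn, hlt⟩ := h
  refine ⟨n + 1, by rwa [play_succ], fun m hm Q => ?_⟩
  cases m with
  | zero => exact hp Q
  | succ m => rw [play_succ]; exact hlt m (by omega) Q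

theorem PlayWonBy.congr {t : Tree} {κ : ℕ} {s s' : Player → Strategy t} {p : Position} {P : Player}
    (h : ∀ P u, p.vertex <+: u → (s P).1 u = (s' P).1 u) (hs : PlayWonBy t κ s p P) :
    PlayWonBy t κ s' p P := by
  obtain ⟨n, hn, hlt⟩ := hs
  refine ⟨n, by rwa [← play_congr t p h], fun m hm Q => ?_⟩
  rw [← play_congr t p h]
  exact hlt m hm Q

/-- A strategy that always moves to the first child. -/
def firstChild (t : Tree) : Strategy t := ⟨fun _ => 0, fun _ h => h⟩

theorem HasWinningStrategy.of_wonBy {t : Tree} {κ : ℕ} {p : Position} {P : Player}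
    (h : WonBy t κ p P) : HasWinningStrategy t κ p P :=
  ⟨firstChild t, fun _ _ => ⟨0, h, fun _ hm => absurd hm (Nat.not_lt_zero _)⟩⟩

/-- If `σ` wins from the position `q` and the strategy that `s` prescribes for `P` agrees with `σ`
below `q`, then `s` leads to a win of `P`. -/
theorem playWonBy_of_agree {t : Tree} {κ : ℕ} {q : Position} {P : Player} {σ : Strategy t}
    (hσ : ∀ s : Player → Strategy t, s P = σ → PlayWonBy t κ s q P) (s : Player → Strategy t)
    (h : ∀ u, q.vertex <+: u → (s P).1 u = σ.1 u) : PlayWonBy t κ s q P := by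
  refine (hσ (Function.update s P σ) (by simp)).congr fun Q u hu => ?_
  by_cases hQ : Q = P
  · subst hQ; simp [h u hu]
  · simp [hQ]

/-- Redirecting a winning strategy at the current vertex is harmless: the play never returns to it,
since vertices only get longer. -/
theorem HasWinningStrategy.of_move {t : Tree} {κ : ℕ} {p : Position}
    (hp : ∀ Q, ¬ WonBy t κ p Q) {k : ℕ} (hk : k < t.numChildren p.vertex)
    (h : HasWinningStrategy t κ (move t p k) p.turn) : HasWinningStrategy t κ p p.turn := by
  obtain ⟨σ, hσ⟩ := h
  refine ⟨⟨Function.update σ.1 p.vertex k, fun u hu => ?_⟩, fun s hs => ?_⟩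
  · by_cases h : u = p.vertex
    · subst h; simpa using hk
    · simpa [h] using σ.2 u hu
  · refine .of_move hp ?_
    rw [hs]
    simp only [Function.update_self]
    refine playWonBy_of_agree hσ s fun u hu => ?_
    rw [hs]
    have : u ≠ p.vertex := by
      rintro rfl
      have := hu.length_le
      simp [move] at this
    simp [this]

theorem HasWinningStrategy.of_forall_move {t : Tree} {κ : ℕ} {p : Position}
    (hp : ∀ Q, ¬ WonBy t κ p Q) (hpos : 0 < t.numChildren p.vertex) {P : Player}
    (h : ∀ k < t.numChildren p.vertex, HasWinningStrategy t κ (move t p k) P) :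
    HasWinningStrategy t κ p P := by
  have : Nonempty (Strategy t) := ⟨firstChild t⟩
  choose! σ hσ using h
  -- Below `p.vertex`, the letter at index `p.vertex.length` tells which child was entered, hence
  -- which strategy to follow. The default 0 only matters at words too short to lie below such a
  -- child.
  refine ⟨⟨fun u => (σ (u.getD p.vertex.length 0)).1 u, fun u hu => (σ _).2 u hu⟩,
    fun s hs => .of_move hp ?_⟩
  refine playWonBy_of_agree (hσ _ ((s p.turn).2 _ hpos)) s fun u hu => ?_
  rw [hs]
  obtain ⟨v, rfl⟩ := hu
  simp [move]

theorem Player.eq_or_eq_opponent (P Q : Player) : P = Q ∨ P = Q.opponent := by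
  cases P <;> cases Q <;> simp [Player.opponent]

theorem Player.opponent_ne (P : Player) : P.opponent ≠ P := by
  cases P <;> simp [Player.opponent]

theorem Player.opponent_opponent (P : Player) : P.opponent.opponent = P := by
  cases P <;> rfl

/-- From a position that neither player can win, the player whose turn it is can move to another
such position. -/
theorem exists_move_draw {t : Tree} {κ : ℕ} {p : Position}
    (h : ∀ P, ¬ HasWinningStrategy t κ p P) :
    ∃ k < t.numChildren p.vertex, ∀ P, ¬ HasWinningStrategy t κ (move t p k) P := by
  have hp : ∀ Q, ¬ WonBy t κ p Q := fun Q hQ => h Q (.of_wonBy hQ)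
  have hpos : 0 < t.numChildren p.vertex := by
    rw [Nat.pos_iff_ne_zero]
    intro h0
    exact hp p.turn.opponent <| .inr ⟨fun Q hQ => hp Q (.inl hQ),
      (Player.opponent_opponent _).symm, h0⟩
  by_contra! hc
  refine h p.turn.opponent (.of_forall_move hp hpos fun k hk => ?_)
  obtain ⟨P, hP⟩ := hc k hk
  rcases P.eq_or_eq_opponent p.turn with rfl | rfl
  · exact absurd (HasWinningStrategy.of_move hp hk hP) (h _)
  · exact hP

/-! ### Forced weights for target capital 3. -/

/-- The capital `1` or `2`, encoded by a Boolean. -/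
def smallCapital (b : Bool) : ℤ := if b then 2 else 1

/-- With target capital `3`, the only weight in `{-1, 1}` that does not end the game at once when it
is added to the capital `smallCapital b`. -/
def continuingWeight (b : Bool) : ℤ := if b then -1 else 1

/-- There is a downward path with `n` edges that starts at `u` such that its edges, together with
the edge into `u`, all have the weights that keep the game undecided when the edge into `u` is
traversed by a player with capital `smallCapital i` whose opponent has capital `smallCapital j`. -/
def HasUndecidedPath (t : Tree) : ℕ → Bool → Bool → List ℕ → Prop
  | 0, i, _, u => (t u).2 = continuingWeight i
  | n + 1, i, j, u => (t u).2 = continuingWeight i ∧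
      ∃ k < t.numChildren u, HasUndecidedPath t n j (!i) (u ++ [k])

theorem HasUndecidedPath.of_succ {t : Tree} {n : ℕ} {i j : Bool} {u : List ℕ}
    (h : HasUndecidedPath t (n + 1) i j u) : HasUndecidedPath t n i j u := by
  induction n generalizing i j u with
  | zero => exact h.1
  | succ n ih =>
    obtain ⟨h1, k, hk, h2⟩ := h
    exact ⟨h1, k, hk, ih h2⟩

/-- In a drawn position the token can be moved, along the continuing weight, to a drawn position. -/
theorem exists_move_draw_three {t : Tree} (ht : ∀ u, (t u).2 = 1 ∨ (t u).2 = -1) {p : Position}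
    {i j : Bool} (hi : p.capital p.turn = smallCapital i)
    (hj : p.capital p.turn.opponent = smallCapital j)
    (h : ∀ P, ¬ HasWinningStrategy t 3 p P) :
    ∃ k < t.numChildren p.vertex, (t (p.vertex ++ [k])).2 = continuingWeight i ∧
      (move t p k).capital (move t p k).turn = smallCapital j ∧
      (move t p k).capital (move t p k).turn.opponent = smallCapital (!i) ∧
      ∀ P, ¬ HasWinningStrategy t 3 (move t p k) P := by
  obtain ⟨k, hk, hd⟩ := exists_move_draw h
  have hw : (t (p.vertex ++ [k])).2 = continuingWeight i := by
    have h1 : ¬ CapitalWin 3 (move t p k) p.turn := fun h => hd _ (.of_wonBy (.inl h))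
    have h2 : ¬ CapitalWin 3 (move t p k) p.turn.opponent := fun h => hd _ (.of_wonBy (.inl h))
    simp only [CapitalWin, move, Player.opponent_opponent, Function.update_self, hi,
      Tree.edgeWeight, not_or, not_le] at h1 h2
    rcases ht (p.vertex ++ [k]) with h | h <;> rw [h] at h1 h2 ⊢ <;> cases i <;>
      simp [smallCapital, continuingWeight] at h1 h2 ⊢
  refine ⟨k, hk, hw, ?_, ?_, hd⟩
  · simp [move, hj, Player.opponent_ne]
  · simp only [move, Player.opponent_opponent, Function.update_self, hi, Tree.edgeWeight, hw]
    cases i <;> simp [smallCapital, continuingWeight]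

/-- The player who has just moved had capital `smallCapital i`; the continuing weight turned it into
`smallCapital (!i)`. The roles then swap, so `(i, j)` becomes `(j, !i)`. -/
theorem hasUndecidedPath_of_draw {t : Tree} (ht : ∀ u, (t u).2 = 1 ∨ (t u).2 = -1) (n : ℕ)
    {p : Position} {i j : Bool} (hi : p.capital p.turn.opponent = smallCapital (!i))
    (hj : p.capital p.turn = smallCapital j) (hw : (t p.vertex).2 = continuingWeight i)
    (h : ∀ P, ¬ HasWinningStrategy t 3 p P) : HasUndecidedPath t n i j p.vertex := by
  induction n generalizing p i j with
  | zero => exact hw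
  | succ n ih =>
    obtain ⟨k, hk, hkw, h1, h2, hd⟩ := exists_move_draw_three ht hj hi h
    exact ⟨hw, k, hk, ih h2 h1 hkw hd⟩

/-- One child serves all lengths `n`, so a union bound over the children suffices later. -/
theorem exists_hasUndecidedPath_of_isDraw {t : Tree} (ht : ∀ u, (t u).2 = 1 ∨ (t u).2 = -1)
    {i j : ℕ} {b c : Bool} (hi : (i : ℤ) = smallCapital b) (hj : (j : ℤ) = smallCapital c)
    {v : List ℕ} (h : IsDraw i j 3 t v) : ∃ k, ∀ n, HasUndecidedPath t n b c (v ++ [k]) := by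
  obtain ⟨k, -, hkw, h1, h2, hd⟩ :=
    exists_move_draw_three ht (p := startPosition i j v) (i := b) (j := c) hi hj h
  exact ⟨k, fun n => hasUndecidedPath_of_draw ht n h2 h1 hkw hd⟩

/-! ### Locality and independence of path events. -/

/-- The σ-algebra generated by the labels of the words in `S`. -/
@[reducible] def labelAlgebra (S : Set (List ℕ)) : MeasurableSpace Tree :=
  ⨆ u ∈ S, MeasurableSpace.comap (fun t : Tree => t u) inferInstance

theorem labelAlgebra_le (S : Set (List ℕ)) :
    labelAlgebra S ≤ (inferInstance : MeasurableSpace Tree) :=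
  iSup₂_le fun u _ => (measurable_pi_apply u).comap_le

theorem labelAlgebra_mono {S T : Set (List ℕ)} (h : S ⊆ T) : labelAlgebra S ≤ labelAlgebra T :=
  biSup_mono h

theorem measurableSet_label {S : Set (List ℕ)} {u : List ℕ} (hu : u ∈ S) (B : Set (ℕ × ℤ)) :
    MeasurableSet[labelAlgebra S] {t : Tree | t u ∈ B} :=
  le_iSup₂ (f := fun v (_ : v ∈ S) => MeasurableSpace.comap (fun t : Tree => t v) inferInstance)
    u hu _ ⟨B, .of_discrete, rfl⟩

theorem measurableSet_hasUndecidedPath (n : ℕ) (i j : Bool) (u : List ℕ) :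
    MeasurableSet[labelAlgebra {v | u <+: v}] {t | HasUndecidedPath t n i j u} := by
  induction n generalizing i j u with
  | zero =>
    exact measurableSet_label (u := u) (List.prefix_rfl) {x | x.2 = continuingWeight i}
  | succ n ih =>
    have : {t | HasUndecidedPath t (n + 1) i j u} =
        {t : Tree | t u ∈ {x : ℕ × ℤ | x.2 = continuingWeight i}} ∩ ⋃ k : ℕ,
          {t : Tree | t u ∈ {x : ℕ × ℤ | k < x.1}} ∩
            {t | HasUndecidedPath t n j (!i) (u ++ [k])} := by
      ext t
      simp [HasUndecidedPath, Tree.numChildren]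
    rw [this]
    refine MeasurableSet.inter (measurableSet_label (S := {v | u <+: v}) List.prefix_rfl _)
      (MeasurableSet.iUnion fun k => .inter
        (measurableSet_label (S := {v | u <+: v}) List.prefix_rfl _) ?_)
    exact labelAlgebra_mono (fun v hv => (List.prefix_append u [k]).trans hv) _ (ih j (!i) _)

theorem measurableSet_forall_not_hasUndecidedPath (n : ℕ) (i j : Bool) (u : List ℕ) (m : ℕ) :
    MeasurableSet[labelAlgebra {v | ∃ k < m, u ++ [k] <+: v}]
      {t | ∀ k < m, ¬ HasUndecidedPath t n i j (u ++ [k])} := by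
  have : {t | ∀ k < m, ¬ HasUndecidedPath t n i j (u ++ [k])} =
      ⋂ k : ℕ, ⋂ _ : k < m, {t | HasUndecidedPath t n i j (u ++ [k])}ᶜ := by
    ext t; simp
  rw [this]
  refine MeasurableSet.iInter fun k => MeasurableSet.iInter fun hk => MeasurableSet.compl ?_
  have hsub : {v | u ++ [k] <+: v} ⊆ {v | ∃ k < m, u ++ [k] <+: v} := fun v hv => ⟨k, hk, hv⟩
  exact labelAlgebra_mono hsub _ (measurableSet_hasUndecidedPath n i j _)

section Law

variable {χ : Measure ℕ} [IsProbabilityMeasure χ] {pm p0 p1 : ℝ}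

theorem treeLaw_label (hm : 0 ≤ pm) (h0 : 0 ≤ p0) (h1 : 0 ≤ p1) (hsum : pm + p0 + p1 = 1)
    (u : List ℕ) (B : Set (ℕ × ℤ)) :
    treeLaw χ pm p0 p1 {t | t u ∈ B} = χ.prod (weightLaw pm p0 p1) B := by
  have := isProbabilityMeasure_weightLaw hm h0 h1 hsum
  exact (measurePreserving_eval_infinitePi (fun _ : List ℕ => χ.prod (weightLaw pm p0 p1))
    u).measure_preimage (MeasurableSet.of_discrete (s := B)).nullMeasurableSet

theorem indep_labelAlgebra (hm : 0 ≤ pm) (h0 : 0 ≤ p0) (h1 : 0 ≤ p1) (hsum : pm + p0 + p1 = 1)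
    {S T : Set (List ℕ)} (h : Disjoint S T) :
    Indep (labelAlgebra S) (labelAlgebra T) (treeLaw χ pm p0 p1) := by
  have := isProbabilityMeasure_weightLaw hm h0 h1 hsum
  refine indep_iSup_of_disjoint (fun u => (measurable_pi_apply u).comap_le) ?_ h
  exact (iIndepFun_infinitePi (P := fun _ : List ℕ => χ.prod (weightLaw pm p0 p1))
    (X := fun _ x => x) (fun _ => measurable_id)).iIndep

theorem treeLaw_real_inter (hm : 0 ≤ pm) (h0 : 0 ≤ p0) (h1 : 0 ≤ p1) (hsum : pm + p0 + p1 = 1)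
    {S T : Set (List ℕ)} (h : Disjoint S T) {A B : Set Tree} (hA : MeasurableSet[labelAlgebra S] A)
    (hB : MeasurableSet[labelAlgebra T] B) :
    (treeLaw χ pm p0 p1).real (A ∩ B) =
      (treeLaw χ pm p0 p1).real A * (treeLaw χ pm p0 p1).real B := by
  simp only [measureReal_def]
  rw [(Indep_iff _ _ _).1 (indep_labelAlgebra hm h0 h1 hsum h) A B hA hB, ENNReal.toReal_mul]

/-- The probability that none of the first `m` children of `u` starts an undecided path. -/
theorem treeLaw_real_forall_not_hasUndecidedPath (hm : 0 ≤ pm) (h0 : 0 ≤ p0) (h1 : 0 ≤ p1)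
    (hsum : pm + p0 + p1 = 1) {n : ℕ} {i j : Bool} {u : List ℕ} {c : ℝ}
    (hc : ∀ k, (treeLaw χ pm p0 p1).real {t | HasUndecidedPath t n i j (u ++ [k])} = c) (m : ℕ) :
    (treeLaw χ pm p0 p1).real {t | ∀ k < m, ¬ HasUndecidedPath t n i j (u ++ [k])} =
      (1 - c) ^ m := by
  have := isProbabilityMeasure_treeLaw χ hm h0 h1 hsum
  induction m with
  | zero => simp
  | succ m ih =>
    have hset : {t | ∀ k < m + 1, ¬ HasUndecidedPath t n i j (u ++ [k])} =
        {t | ∀ k < m, ¬ HasUndecidedPath t n i j (u ++ [k])} ∩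
          {t | HasUndecidedPath t n i j (u ++ [m])}ᶜ := by
      ext t
      simp only [Set.mem_ofPred_eq, Set.mem_inter_iff, Set.mem_compl_iff]
      exact Nat.forall_lt_succ_right
    have hmeas : MeasurableSet {t | HasUndecidedPath t n i j (u ++ [m])} :=
      labelAlgebra_le _ _ (measurableSet_hasUndecidedPath n i j _)
    rw [hset, treeLaw_real_inter (S := {v | ∃ k < m, u ++ [k] <+: v})
      (T := {v | u ++ [m] <+: v}) hm h0 h1 hsum, ih, probReal_compl_eq_one_sub hmeas, hc, pow_succ]
    -- Subtrees of distinct siblings are disjoint: two prefixes of one word with equal length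
    -- coincide.
    · rw [Set.disjoint_left]
      rintro v ⟨k, hk, hkv⟩ hmv
      have := List.prefix_of_prefix_length_le hkv hmv (by simp)
      simp at this
      omega
    · exact measurableSet_forall_not_hasUndecidedPath n i j u m
    · exact (measurableSet_hasUndecidedPath n i j _).compl

/-- The probability that there is an undecided path of a given length; `G` stands for the
generating function of the offspring distribution. -/
noncomputable def undecidedProb (ν : Measure ℤ) (G : ℝ → ℝ) : ℕ → Bool → Bool → ℝ
  | 0, i, _ => ν.real {continuingWeight i}
  | n + 1, i, j => ν.real {continuingWeight i} * (1 - G (1 - undecidedProb ν G n j (!i)))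

/-- Conditioning on the offspring number `m` of `u`: the label of `u` is independent of everything
below, and all `m` children fail with probability `(1 - c) ^ m`. Summing over `m` produces `G`. -/
theorem treeLaw_real_hasUndecidedPath (hm : 0 ≤ pm) (h0 : 0 ≤ p0) (h1 : 0 ≤ p1)
    (hsum : pm + p0 + p1 = 1) {G : ℝ → ℝ} (hG1 : G 1 = 1)
    (hG : ∀ x, 0 ≤ x → x ≤ 1 → HasSum (fun m => χ.real {m} * x ^ m) (G x))
    (n : ℕ) (i j : Bool) (u : List ℕ) :
    (treeLaw χ pm p0 p1).real {t | HasUndecidedPath t n i j u} =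
      undecidedProb (weightLaw pm p0 p1) G n i j := by
  have := isProbabilityMeasure_treeLaw χ hm h0 h1 hsum
  have := isProbabilityMeasure_weightLaw hm h0 h1 hsum
  induction n generalizing i j u with
  | zero =>
    have := treeLaw_label (χ := χ) hm h0 h1 hsum u (Set.univ ×ˢ {continuingWeight i})
    rw [Measure.prod_prod, measure_univ, one_mul] at this
    rw [undecidedProb, measureReal_def, measureReal_def, ← this]
    congr 2
    ext t
    simp [HasUndecidedPath]
  | succ n ih =>
    set c := undecidedProb (weightLaw pm p0 p1) G n j (!i) with hc
    have hc0 : 0 ≤ c := by rw [hc, ← ih j (!i) []]; exact measureReal_nonneg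
    have hc1 : c ≤ 1 := by rw [hc, ← ih j (!i) []]; exact measureReal_le_one
    let A : ℕ → Set Tree := fun m => {t | t u ∈ {m} ×ˢ {continuingWeight i}} ∩
      {t | ∀ k < m, ¬ HasUndecidedPath t n j (!i) (u ++ [k])}ᶜ
    have hB (m : ℕ) : MeasurableSet[labelAlgebra {u}ᶜ]
        {t | ∀ k < m, ¬ HasUndecidedPath t n j (!i) (u ++ [k])} := by
      have hsub : {v | ∃ k < m, u ++ [k] <+: v} ⊆ ({u}ᶜ : Set (List ℕ)) := by
        rintro v ⟨k, -, hv⟩ rfl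
        simpa using hv.length_le
      exact labelAlgebra_mono hsub _ (measurableSet_forall_not_hasUndecidedPath n j (!i) u m)
    have hlab (m : ℕ) : MeasurableSet[labelAlgebra {u}]
        {t : Tree | t u ∈ ({m} ×ˢ {continuingWeight i} : Set (ℕ × ℤ))} :=
      measurableSet_label (Set.mem_singleton u) _
    have hA (m : ℕ) : (treeLaw χ pm p0 p1).real (A m) =
        χ.real {m} * (weightLaw pm p0 p1).real {continuingWeight i} * (1 - (1 - c) ^ m) := by
      have hlabel : (treeLaw χ pm p0 p1).real
          {t : Tree | t u ∈ ({m} ×ˢ {continuingWeight i} : Set (ℕ × ℤ))} =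
          χ.real {m} * (weightLaw pm p0 p1).real {continuingWeight i} := by
        rw [measureReal_def, treeLaw_label hm h0 h1 hsum, Measure.prod_prod, ENNReal.toReal_mul]
        rfl
      rw [treeLaw_real_inter hm h0 h1 hsum disjoint_compl_right (hlab m) (hB m).compl, hlabel,
        probReal_compl_eq_one_sub (labelAlgebra_le _ _ (hB m)),
        treeLaw_real_forall_not_hasUndecidedPath hm h0 h1 hsum (fun k => ih j (!i) _)]
    have hset : {t | HasUndecidedPath t (n + 1) i j u} = ⋃ m, A m := by
      ext t
      simp [HasUndecidedPath, Tree.numChildren, A, Prod.ext_iff, and_assoc]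
    have hdisj : Pairwise (Function.onFun Disjoint A) := by
      intro m m' hmm
      refine Set.disjoint_left.2 fun t ht ht' => hmm ?_
      have h1 := ht.1.1
      have h2 := ht'.1.1
      simp only [Set.mem_singleton_iff] at h1 h2
      rw [← h1, ← h2]
    have hsum1 : HasSum (fun m => (treeLaw χ pm p0 p1).real (A m))
        ((treeLaw χ pm p0 p1).real {t | HasUndecidedPath t (n + 1) i j u}) := by
      rw [hset]
      have hmeas (m : ℕ) : MeasurableSet (A m) :=
        (labelAlgebra_le _ _ (hlab m)).inter (labelAlgebra_le _ _ (hB m)).compl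
      have hU := measure_iUnion (μ := treeLaw χ pm p0 p1) hdisj hmeas
      have hfin : ∑' m, treeLaw χ pm p0 p1 (A m) ≠ ⊤ := hU ▸ measure_ne_top _ _
      have := ENNReal.hasSum_toReal hfin
      rwa [← ENNReal.tsum_toReal_eq fun m => measure_ne_top _ _, ← hU] at this
    have hsum2 : HasSum (fun m => (treeLaw χ pm p0 p1).real (A m))
        ((weightLaw pm p0 p1).real {continuingWeight i} * (1 - G (1 - c))) := by
      have := ((hG 1 zero_le_one le_rfl).sub (hG (1 - c) (by linarith) (by linarith))).mul_left
        ((weightLaw pm p0 p1).real {continuingWeight i})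
      rw [hG1] at this
      refine this.congr_fun fun m => ?_
      rw [hA]; ring
    exact hsum1.unique hsum2

end Law

/-! ### Extinction, and draws as null events. -/

theorem ae_weight_eq {χ : Measure ℕ} [IsProbabilityMeasure χ] {pm p1 : ℝ} (hm : 0 ≤ pm)
    (h1 : 0 ≤ p1) (hsum : pm + 0 + p1 = 1) :
    ∀ᵐ t ∂treeLaw χ pm 0 p1, ∀ u, (t u).2 = 1 ∨ (t u).2 = -1 := by
  rw [ae_all_iff]
  intro u
  have h := treeLaw_label (χ := χ) hm le_rfl h1 hsum u (Set.univ ×ˢ ({1, -1} : Set ℤ)ᶜ)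
  have := isProbabilityMeasure_weightLaw hm le_rfl h1 hsum
  rw [Measure.prod_prod] at h
  have h0 : weightLaw pm 0 p1 ({1, -1} : Set ℤ)ᶜ = 0 := by simp [weightLaw]
  rw [h0, mul_zero] at h
  rw [ae_iff, ← h]
  congr 1
  ext t
  simp

/-- If `G` has slope less than `2` towards `1`, then the probability that there is an undecided
path of length `n` tends to `0`. -/
theorem tendsto_undecidedProb {ν : Measure ℤ} [IsProbabilityMeasure ν] {G : ℝ → ℝ}
    (hGc : Continuous G) (hG1 : G 1 = 1) (hG : ∀ x, 0 < x → 1 - G (1 - x) < 2 * x)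
    (h0 : ∀ n i j, 0 ≤ undecidedProb ν G n i j)
    (hanti : ∀ i j, Antitone fun n => undecidedProb ν G n i j) (i j : Bool) :
    Filter.Tendsto (fun n => undecidedProb ν G n i j) Filter.atTop (nhds 0) := by
  have hlim (i j : Bool) := tendsto_atTop_ciInf (hanti i j) ⟨0, by rintro _ ⟨n, rfl⟩; exact h0 n i j⟩
  set l : Bool → Bool → ℝ := fun i j => ⨅ n, undecidedProb ν G n i j with hl
  set w : Bool → ℝ := fun b => ν.real {continuingWeight b} with hw
  have hw0 (b : Bool) : 0 ≤ w b := measureReal_nonneg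
  have hw1 : w true + w false ≤ 1 := by
    rw [hw]
    dsimp only
    rw [← measureReal_union (by simp [continuingWeight]) .of_discrete]
    exact measureReal_le_one
  have hl0 (i j : Bool) : 0 ≤ l i j := ge_of_tendsto' (hlim i j) fun n => h0 n i j
  -- By continuity of `G` the limits solve the fixed-point equations of the recursion.
  have hrec (i j : Bool) : l i j = w i * (1 - G (1 - l j (!i))) := by
    refine tendsto_nhds_unique ((hlim i j).comp (Filter.tendsto_add_atTop_nat 1)) ?_
    exact ((hGc.tendsto _ |>.comp ((hlim j (!i)).const_sub 1)).const_sub 1).const_mul (w i)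
  have hle (i j : Bool) : l i j ≤ 2 * w i * l j (!i) := by
    rw [hrec i j]
    rcases (hl0 j (!i)).eq_or_lt with h | h
    · simp [← h, hG1]
    · nlinarith [hG _ h, hw0 i]
  have hlt (i j : Bool) (h : 0 < l i j) : l i j < 2 * w i * l j (!i) := by
    have hr := hrec i j
    have hwi : 0 < w i := (hw0 i).lt_of_ne fun h' => by rw [hr, ← h', zero_mul] at h; exact h.false
    have hl' : 0 < l j (!i) := (hl0 _ _).lt_of_ne fun h' => by
      rw [hr, ← h', sub_zero, hG1, sub_self, mul_zero] at h; exact h.false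
    rw [hr]
    nlinarith [hG _ hl']
  have hff : l false false = 0 := by
    by_contra hne
    have hpos : 0 < l false false := (hl0 _ _).lt_of_ne' hne
    -- Once around the cycle of capitals; a single strict inequality is enough for the
    -- contradiction.
    have e0 := hlt _ _ hpos
    have e1 := hle false true
    have e2 := hle true true
    have e3 := hle true false
    simp only [Bool.not_true, Bool.not_false] at e0 e1 e2 e3
    set p := w false
    set q := w true
    have hp : 0 ≤ p := hw0 _
    have hq : 0 ≤ q := hw0 _
    -- 4pq ≤ (p + q)² ≤ 1.
    have hpq : 4 * (p * q) ≤ 1 := by nlinarith [sq_nonneg (p - q)]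
    have hpq0 : 0 ≤ 4 * (p * q) := by positivity
    have f1 : l true true ≤ 4 * (q * q) * l false false := by nlinarith
    have f2 : l false true ≤ 2 * p * (4 * (q * q) * l false false) :=
      e1.trans (mul_le_mul_of_nonneg_left f1 (by positivity))
    have f3 : 2 * p * l false true ≤ (4 * (p * q)) ^ 2 * l false false :=
      (mul_le_mul_of_nonneg_left f2 (by positivity : 0 ≤ 2 * p)).trans (by nlinarith)
    have f4 : (4 * (p * q)) ^ 2 * l false false ≤ 1 * l false false :=
      mul_le_mul_of_nonneg_right (pow_le_one₀ hpq0 hpq) hpos.le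
    linarith
  have htf : l true false = 0 := le_antisymm (by simpa [hff] using hle true false) (hl0 _ _)
  have htt : l true true = 0 := le_antisymm (by simpa [htf] using hle true true) (hl0 _ _)
  have hft : l false true = 0 := le_antisymm (by simpa [htt] using hle false true) (hl0 _ _)
  have hzero : l i j = 0 := by cases i <;> cases j <;> assumption
  rw [← hzero]
  exact hlim i j

/-- Measurability of the draw event is not needed: up to a null set it lies in a countable union,
over the children of the root, of null events. -/
theorem drawProb_eq_zero {χ : Measure ℕ} [IsProbabilityMeasure χ] {pm p1 : ℝ} (hm : 0 ≤ pm)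
    (h1 : 0 ≤ p1) (hsum : pm + 0 + p1 = 1) {G : ℝ → ℝ} (hGc : Continuous G) (hG1 : G 1 = 1)
    (hG : ∀ x, 0 < x → 1 - G (1 - x) < 2 * x)
    (hGs : ∀ x, 0 ≤ x → x ≤ 1 → HasSum (fun m => χ.real {m} * x ^ m) (G x)) {i j : ℕ}
    {b c : Bool} (hi : (i : ℤ) = smallCapital b) (hj : (j : ℤ) = smallCapital c) :
    drawProb χ pm 0 p1 3 i j = 0 := by
  have := isProbabilityMeasure_treeLaw χ hm le_rfl h1 hsum
  have := isProbabilityMeasure_weightLaw hm le_rfl h1 hsum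
  have hP := treeLaw_real_hasUndecidedPath (χ := χ) hm le_rfl h1 hsum hG1 hGs
  have hlim := tendsto_undecidedProb (ν := weightLaw pm 0 p1) hGc hG1 hG
    (fun n i j => hP n i j [] ▸ measureReal_nonneg)
    (fun i j => antitone_nat_of_succ_le fun n => by
      rw [← hP n i j [], ← hP (n + 1) i j []]
      exact measureReal_mono fun t ht => ht.of_succ) b c
  have hnull (k : ℕ) : treeLaw χ pm 0 p1 {t | ∀ n, HasUndecidedPath t n b c ([] ++ [k])} = 0 := by
    rw [← measureReal_eq_zero_iff]
    refine le_antisymm (ge_of_tendsto' hlim fun n => ?_) measureReal_nonneg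
    rw [← hP n b c ([] ++ [k])]
    exact measureReal_mono fun t ht => ht n
  have hU := measure_iUnion_null hnull
  have hae : ∀ᵐ t ∂treeLaw χ pm 0 p1, ¬ IsDraw i j 3 t [] := by
    filter_upwards [ae_weight_eq (χ := χ) hm h1 hsum, measure_eq_zero_iff_ae_notMem.1 hU]
      with t ht hU hd
    obtain ⟨k, hk⟩ := exists_hasUndecidedPath_of_isDraw ht hi hj hd
    exact hU (Set.mem_iUnion.2 ⟨k, hk⟩)
  simpa [ae_iff, drawProb] using hae

/-! ### The two generating functions. -/

theorem hasSum_dirac_two (x : ℝ) :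
    HasSum (fun m => (Measure.dirac 2 : Measure ℕ).real {m} * x ^ m) (x ^ 2) := by
  convert hasSum_ite_eq 2 (x ^ 2) using 2 with m
  by_cases h : m = 2
  · subst h; simp [measureReal_def]
  · simp [measureReal_def, h, Ne.symm h]

theorem hasSum_poissonMeasure_two (x : ℝ) :
    HasSum (fun m => (poissonMeasure 2).real {m} * x ^ m) (Real.exp (2 * (x - 1))) := by
  have h := (NormedSpace.expSeries_div_hasSum_exp (2 * x : ℝ)).mul_left (Real.exp (-2))
  rw [← Real.exp_eq_exp_ℝ, ← Real.exp_add] at h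
  rw [show 2 * (x - 1) = -2 + 2 * x by ring]
  refine h.congr_fun fun m => ?_
  rw [poissonMeasure_real_singleton, mul_pow]
  simp only [NNReal.coe_ofNat]
  ring

end WeightedTreeGame

theorem corollary1 (χ : Measure ℕ) (hχ : χ = Measure.dirac 2 ∨ χ = poissonMeasure 2)
    (pm p0 p1 : ℝ) (hm : 0 ≤ pm) (h1 : 0 ≤ p1) (h0 : p0 = 0) (hsum : pm + p0 + p1 = 1) :
    ∀ i ∈ ({1, 2} : Finset ℕ), ∀ j ∈ ({1, 2} : Finset ℕ),
      WeightedTreeGame.drawProb χ pm p0 p1 3 i j = 0 := by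
  intro i hi j hj
  subst h0
  have hcap (i : ℕ) (hi : i ∈ ({1, 2} : Finset ℕ)) :
      ∃ b, (i : ℤ) = WeightedTreeGame.smallCapital b := by
    rcases Finset.mem_insert.1 hi with rfl | hi
    · exact ⟨false, rfl⟩
    · rw [Finset.mem_singleton.1 hi]; exact ⟨true, rfl⟩
  obtain ⟨b, hb⟩ := hcap i hi
  obtain ⟨c, hc⟩ := hcap j hj
  rcases hχ with rfl | rfl
  · exact WeightedTreeGame.drawProb_eq_zero hm h1 hsum (G := fun x => x ^ 2) (by fun_prop)
      (by norm_num) (fun x hx => by nlinarith)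
      (fun x _ _ => WeightedTreeGame.hasSum_dirac_two x) hb hc
  · refine WeightedTreeGame.drawProb_eq_zero hm h1 hsum
      (G := fun x => Real.exp (2 * (x - 1))) (by fun_prop) (by norm_num) (fun x hx => ?_)
      (fun x _ _ => WeightedTreeGame.hasSum_poissonMeasure_two x) hb hc
    -- The strict bound e⁻²ˣ > 1 - 2x.
    have := Real.add_one_lt_exp (x := 2 * (1 - x - 1)) (by linarith)
    linarith
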